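/- For positive integers $s_1,\dots,s_l$ and signs $x_1,\dots,x_l\in\{1,-1\}$ consider the (alternating) Euler sum $$\zeta(s_1,\dots,s_l;x_1,\dots,x_l)=\sum_{k_1>\cdots>k_l>0}\ \prod_{j=1}^{l}\frac{x_j^{k_j}}{k_j^{s_j}}=\lim_{N\to\infty}\ \sum_{N\ge k_1>\cdots>k_l>0}\ \prod_{j=1}^{l}\frac{x_j^{k_j}}{k_j^{s_j}}$$ whenever the limit exists. Write $\zeta(\dots)$ listing only the entries $s_j$, with $\overline{s_j}$ in place of $s_j$ when $x_j=-1$, and write $\{S\}^n$ for the string $S$ repeated $n$ times. Then for every positive integer $n$ the Euler sums $\zeta(\{3\}^n)$ and $\zeta(\{\overline{2},1\}^n)$ converge and $$\zeta(\{3\}^n)=8^n\,\zeta(\{\overline{2},1\}^n).$$ Explicitly, $$\sum_{k_1>\cdots>k_n>0}\frac{1}{k_1^3\cdots k_n^3}=8^n\sum_{l_1>k_1>l_2>k_2>\cdots>l_n>k_n>0}\ \prod_{i=1}^{n}\frac{(-1)^{l_i}}{l_i^{2}\,k_i}.$$ -/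

import Mathlib

open Filter Topology

/-- A signed index: a list of pairs `(s, x)` of a positive integer `s` and a sign `x = ±1`.
A pair `(s, -1)` stands for a barred entry, and `(s, 1)` for an unbarred one. -/
abbrev SignedIndex : Type := List (ℕ+ × ℤˣ)

namespace SignedIndex

/-- `{S}^n`: the string `S` repeated `n` times. -/
def rep (S : SignedIndex) (n : ℕ) : SignedIndex := (List.replicate n S).flatten

/-- The tuples of integers with `N ≥ k₁ > k₂ > ⋯ > k_l > 0`. -/
def decreasingTuples (l N : ℕ) : Finset (Fin l → ℕ) :=
  (Fintype.piFinset fun _ => Finset.Icc 1 N).filter fun k => ∀ i j, i < j → k j < k i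

/-- The summand `∏ⱼ xⱼ ^ kⱼ / kⱼ ^ sⱼ`. -/
noncomputable def eulerTerm (S : SignedIndex) (k : Fin S.length → ℕ) : ℝ :=
  ∏ j, (((S.get j).2 : ℤ) : ℝ) ^ k j / (k j : ℝ) ^ ((S.get j).1 : ℕ)

/-- The truncated sum, over all `N ≥ k₁ > ⋯ > k_l > 0`. -/
noncomputable def eulerPartialSum (S : SignedIndex) (N : ℕ) : ℝ :=
  ∑ k ∈ decreasingTuples S.length N, eulerTerm S k

/-- The series over `k₁ > ⋯ > k_l > 0` converges: its truncations at `k₁ ≤ N` have a limit.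
This also covers the conditionally convergent sums, whose first entry is a barred `1`. -/
def EulerConverges (S : SignedIndex) : Prop :=
  ∃ z : ℝ, Tendsto (eulerPartialSum S) atTop (𝓝 z)

/-- The alternating Euler sum `ζ(S) = ∑_{k₁ > ⋯ > k_l > 0} ∏ⱼ xⱼ ^ kⱼ / kⱼ ^ sⱼ`
(meaningful when `EulerConverges S` holds). -/
noncomputable def eulerSum (S : SignedIndex) : ℝ :=
  limUnder atTop (eulerPartialSum S)

end SignedIndex

/-! Compare generating functions. Weight depth `n` by `L ^ n`: the truncated sums of `ζ({3}^n)` give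
`∏ (1 + L / i ^ 3)`, and those of the alternating sum give the first component of a linear two-term
system, `altPair`. With `L = A ^ 3` in the product and `L = 8 * A ^ 3` in the system, equality of
the limits as power series in `A ^ 3` is exactly the theorem.

The bridge is an exact formula at even truncations (`altPair_eq_convSum`): the alternating
generating function at `2 * m` is `normQuot A m` times the convolution of `slowQuot` with the terms
of a Gauss series. Both sides satisfy the same second-order recurrence in `m`; for the convolution
it comes from a Zeilberger-type telescoping certificate.

Since `slowQuot` converges and the Gauss terms are summable, the convolution is asymptotically
`slowQuot A m` times the partial Gauss sum. That sum has a closed product form, and after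
multiplication by `normQuot A m` it becomes exactly `∏ (1 + A ^ 3 / i ^ 3)` (`prod_one_add_cube`).
So the two generating functions differ by a null sequence for small `A > 0`. Geometric bounds
uniform in the truncation let the limit pass to the coefficients, and uniqueness of power series
coefficients finishes. -/

namespace SignedIndex

/-! ### Recursion for truncated Euler sums. -/

theorem mem_decreasingTuples {l N : ℕ} {k : Fin l → ℕ} :
    k ∈ decreasingTuples l N ↔ (∀ i, 1 ≤ k i ∧ k i ≤ N) ∧ ∀ i j, i < j → k j < k i := by
  simp [decreasingTuples, Fintype.mem_piFinset]

theorem eulerPartialSum_nil (N : ℕ) : eulerPartialSum [] N = 1 := by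
  have : decreasingTuples 0 N = Finset.univ := by
    ext k
    simp only [mem_decreasingTuples, Finset.mem_univ, iff_true]
    exact ⟨fun i => i.elim0, fun i => i.elim0⟩
  have h1 : eulerTerm [] = fun _ => 1 := by
    funext k
    exact Fin.prod_univ_zero _
  unfold eulerPartialSum
  rw [h1]
  change ∑ _ ∈ decreasingTuples 0 N, (1 : ℝ) = 1
  simp [this]

theorem eulerPartialSum_cons_zero (a : ℕ+ × ℤˣ) (S : SignedIndex) :
    eulerPartialSum (a :: S) 0 = 0 := by
  have : decreasingTuples (a :: S).length 0 = ∅ := by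
    ext k
    simp only [mem_decreasingTuples, Finset.notMem_empty, iff_false]
    rintro ⟨h, -⟩
    have := h ⟨0, by simp⟩
    omega
  rw [eulerPartialSum, this, Finset.sum_empty]

theorem eulerTerm_cons (a : ℕ+ × ℤˣ) (S : SignedIndex) (k : Fin (a :: S).length → ℕ) :
    eulerTerm (a :: S) k =
      ((a.2 : ℤ) : ℝ) ^ k 0 / (k 0 : ℝ) ^ (a.1 : ℕ) * eulerTerm S (fun i => k i.succ) := by
  unfold eulerTerm
  exact Fin.prod_univ_succ _

theorem filter_decreasingTuples_ne (l N : ℕ) :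
    (decreasingTuples (l + 1) (N + 1)).filter (fun k => ¬ k 0 = N + 1) =
      decreasingTuples (l + 1) N := by
  ext k
  simp only [Finset.mem_filter, mem_decreasingTuples]
  constructor
  · rintro ⟨⟨h, hd⟩, hk⟩
    refine ⟨fun i => ⟨(h i).1, ?_⟩, hd⟩
    have h0 := (h 0).2
    rcases Fin.eq_zero_or_eq_succ i with rfl | ⟨j, rfl⟩
    · omega
    · have := hd 0 j.succ (Fin.succ_pos j)
      omega
  · rintro ⟨h, hd⟩
    refine ⟨⟨fun i => ⟨(h i).1, (h i).2.trans (Nat.le_succ N)⟩, hd⟩, ?_⟩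
    have := (h 0).2
    omega

/-- Split the tuples according to whether the largest entry equals `N + 1`; if it does, deleting it
leaves a tuple bounded by `N`. -/
theorem eulerPartialSum_cons_succ (a : ℕ+ × ℤˣ) (S : SignedIndex) (N : ℕ) :
    eulerPartialSum (a :: S) (N + 1) = eulerPartialSum (a :: S) N +
      ((a.2 : ℤ) : ℝ) ^ (N + 1) / ((N : ℝ) + 1) ^ (a.1 : ℕ) * eulerPartialSum S N := by
  unfold eulerPartialSum
  have hsplit := Finset.sum_filter_add_sum_filter_not
    (decreasingTuples (S.length + 1) (N + 1)) (fun k => k 0 = N + 1) (eulerTerm (a :: S))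
  rw [filter_decreasingTuples_ne] at hsplit
  refine hsplit.symm.trans ?_
  rw [add_comm, Finset.mul_sum]
  congr 1
  refine Finset.sum_nbij' (fun k i => k i.succ) (fun k => Fin.cons (N + 1) k) ?_ ?_ ?_ ?_ ?_
  · intro k hk
    simp only [Finset.mem_filter, mem_decreasingTuples] at hk ⊢
    obtain ⟨⟨h, hd⟩, h0⟩ := hk
    refine ⟨fun i => ⟨(h i.succ).1, ?_⟩, fun i j hij => hd _ _ (Fin.succ_lt_succ_iff.2 hij)⟩
    have := hd 0 i.succ (Fin.succ_pos i)
    omega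
  · intro k hk
    simp only [Finset.mem_filter, mem_decreasingTuples] at hk ⊢
    obtain ⟨h, hd⟩ := hk
    refine ⟨⟨fun i => ?_, fun i j hij => ?_⟩, by simp⟩
    · rcases Fin.eq_zero_or_eq_succ i with rfl | ⟨i, rfl⟩
      · simp
      · have := h i
        simp only [Fin.cons_succ]
        omega
    · rcases Fin.eq_zero_or_eq_succ j with rfl | ⟨j, rfl⟩
      · exact absurd hij (Fin.not_lt_zero i)
      · rcases Fin.eq_zero_or_eq_succ i with rfl | ⟨i, rfl⟩
        · have := h j
          simp only [Fin.cons_succ, Fin.cons_zero]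
          omega
        · simpa using hd i j (Fin.succ_lt_succ_iff.1 hij)
  · intro k hk
    have h0 : k 0 = N + 1 := (Finset.mem_filter.1 hk).2
    funext i
    rcases Fin.eq_zero_or_eq_succ i with rfl | ⟨i, rfl⟩
    · simp [h0]
    · simp
  · intro k _
    funext i
    simp
  · intro k hk
    have h0 : k 0 = N + 1 := (Finset.mem_filter.1 hk).2
    have := eulerTerm_cons a S k
    rw [this, h0]
    push_cast
    rfl

theorem rep_succ (S : SignedIndex) (n : ℕ) : rep S (n + 1) = S ++ rep S n := by
  simp [rep, List.replicate_succ]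

end SignedIndex

/-! ### The hypergeometric convolution and its recurrence. -/

/-- Pochhammer quotient `(1/2)_j (1+A)_j / (j! (1/2+A)_j)`. -/
noncomputable def slowQuot (A : ℝ) (j : ℕ) : ℝ :=
  ∏ i ∈ Finset.range j, ((i + 1 / 2) * (i + 1 + A)) / ((i + 1) * (i + 1 / 2 + A))

/-- The terms `(B)_k (C)_k / (k! (1-A)_k)` of a Gauss series with `B + C = -A`, `B C = A ^ 2`. -/
noncomputable def gaussTerm (A : ℝ) (k : ℕ) : ℝ :=
  ∏ i ∈ Finset.range k, ((i : ℝ) ^ 2 - A * i + A ^ 2) / ((i + 1) * (i + 1 - A))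

/-- Pochhammer quotient `(1/2+A)_m (1-A)_m / ((1/2)_m m!)`. -/
noncomputable def normQuot (A : ℝ) (m : ℕ) : ℝ :=
  ∏ i ∈ Finset.range m, ((i + 1 / 2 + A) * (i + 1 - A)) / ((i + 1 / 2) * (i + 1))

/-- Cauchy product of `slowQuot` and `gaussTerm`. -/
noncomputable def convSum (A : ℝ) (m : ℕ) : ℝ :=
  ∑ k ∈ Finset.range (m + 1), slowQuot A (m - k) * gaussTerm A k

theorem slowQuot_succ (A : ℝ) (j : ℕ) : slowQuot A (j + 1) =
    slowQuot A j * (((j + 1 / 2) * (j + 1 + A)) / ((j + 1) * (j + 1 / 2 + A))) :=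
  Finset.prod_range_succ _ _

theorem gaussTerm_succ (A : ℝ) (k : ℕ) : gaussTerm A (k + 1) =
    gaussTerm A k * (((k : ℝ) ^ 2 - A * k + A ^ 2) / ((k + 1) * (k + 1 - A))) :=
  Finset.prod_range_succ _ _

theorem normQuot_succ (A : ℝ) (m : ℕ) : normQuot A (m + 1) =
    normQuot A m * (((m + 1 / 2 + A) * (m + 1 - A)) / ((m + 1 / 2) * (m + 1))) :=
  Finset.prod_range_succ _ _

namespace ConvRec

/-- Coefficient of `convSum A (m + 2)`, with `x = m + 1`. -/
noncomputable def c₁ (A x : ℝ) : ℝ :=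
  8 * (2 * x + 1) * (x + 1) * (4 * x - 1) * (x + 1 / 2 + A) * (x + 1 - A)

/-- Coefficient of `convSum A (m + 1)`, with `x = m + 1`. -/
noncomputable def c₀ (A x : ℝ) : ℝ :=
  -((2 * x + 1) * ((2 * x + 1) ^ 3 + 8 * A ^ 3) * (4 * x - 1)
    + (4 * x + 1) * (4 * x + 3) * (4 * x - 1) + ((2 * x) ^ 3 - 8 * A ^ 3) * (2 * x) * (4 * x + 3))

/-- Coefficient of `convSum A m`, with `x = m + 1`. -/
noncomputable def c₂ (A x : ℝ) : ℝ :=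
  16 * (x ^ 2 + A * x + A ^ 2) * ((x - 1 / 2) ^ 2 - A * (x - 1 / 2) + A ^ 2) * (4 * x + 3)

/-- The quadratic factor of the telescoping certificate. -/
noncomputable def y (A x k : ℝ) : ℝ :=
  (8 + 6 * A + 28 * A ^ 2 + 48 * A ^ 3 + 8 * x + 32 * A * x + 152 * A ^ 2 * x + 112 * A ^ 3 * x
    - 64 * x ^ 2 + 80 * A * x ^ 2 + 208 * A ^ 2 * x ^ 2 + 64 * A ^ 3 * x ^ 2 - 128 * x ^ 3
    + 64 * A * x ^ 3 + 64 * A ^ 2 * x ^ 3 - 64 * x ^ 4)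
  + (-24 - 16 * A - 80 * A ^ 2 - 48 * A ^ 3 + 16 * x - 64 * A * x - 224 * A ^ 2 * x
    - 64 * A ^ 3 * x + 160 * x ^ 2 - 64 * A * x ^ 2 - 128 * A ^ 2 * x ^ 2 + 128 * x ^ 3) * k
  + (16 + 8 * A + 48 * A ^ 2 - 32 * x + 32 * A * x + 64 * A ^ 2 * x - 64 * x ^ 2) * k ^ 2

end ConvRec

-- Creative telescoping with `m = k + j`: the recurrence operator applied to one summand of the
-- convolution is a difference in `k`, with `y` as certificate.
open ConvRec in
theorem convSum_term_telescope {A : ℝ} (h0 : 0 < A) (h1 : A < 1) (k j : ℕ) :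
    c₁ A (k + j + 1) * (slowQuot A (j + 2) * gaussTerm A k)
      + c₀ A (k + j + 1) * (slowQuot A (j + 1) * gaussTerm A k)
      + c₂ A (k + j + 1) * (slowQuot A j * gaussTerm A k)
    = y A (k + j + 1) (k + 1) * (k + 1) * (k + 1 - A) * gaussTerm A (k + 1)
        * (slowQuot A (j + 1) / ((j + 1 / 2) * (j + 1 + A)))
      - y A (k + j + 1) k * k * (k - A) * gaussTerm A k
        * (slowQuot A (j + 2) / ((j + 3 / 2) * (j + 2 + A))) := by
  rw [show j + 2 = (j + 1) + 1 from rfl, slowQuot_succ, slowQuot_succ, gaussTerm_succ]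
  have hj : (0 : ℝ) ≤ j := j.cast_nonneg
  have hk : (0 : ℝ) ≤ k := k.cast_nonneg
  generalize slowQuot A j = a
  generalize gaussTerm A k = b
  push_cast
  generalize (j : ℝ) = j at *
  generalize (k : ℝ) = k at *
  have e1 : k + 1 ≠ 0 := by positivity
  have e2 : k + 1 - A ≠ 0 := by linarith
  have e7 : j + 1 / 2 ≠ 0 := by positivity
  have e8 : j + 1 + A ≠ 0 := by positivity
  -- The whole claim with denominators cleared; `L1` to `R2` below only put each ratio over the
  -- common denominator.
  have key : c₁ A (k + j + 1) * ((j + 1 / 2) * (j + 3 / 2) * (j + 1 + A) * (j + 2 + A))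
      + c₀ A (k + j + 1) * ((j + 2) * (j + 3 / 2 + A) * (j + 1 / 2) * (j + 1 + A))
      + c₂ A (k + j + 1) * ((j + 2) * (j + 1) * (j + 3 / 2 + A) * (j + 1 / 2 + A))
      = y A (k + j + 1) (k + 1) * ((j + 2) * (j + 3 / 2 + A) * (k ^ 2 - A * k + A ^ 2))
      - y A (k + j + 1) k * ((j + 1 / 2) * (j + 1 + A) * k * (k - A)) := by
    unfold c₁ c₀ c₂ y
    ring
  have hD : (j + 1) * (j + 1 / 2 + A) * (j + 2) * (j + 3 / 2 + A) ≠ 0 := by positivity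
  have L1 : (j + 1 / 2) * (j + 1 + A) / ((j + 1) * (j + 1 / 2 + A)) *
      ((j + 1 + 1 / 2) * (j + 1 + 1 + A) / ((j + 1 + 1) * (j + 1 + 1 / 2 + A))) =
      ((j + 1 / 2) * (j + 3 / 2) * (j + 1 + A) * (j + 2 + A)) /
        ((j + 1) * (j + 1 / 2 + A) * (j + 2) * (j + 3 / 2 + A)) := by
    rw [div_mul_div_comm]
    congr 1 <;> ring
  have L2 : (j + 1 / 2) * (j + 1 + A) / ((j + 1) * (j + 1 / 2 + A)) =
      ((j + 2) * (j + 3 / 2 + A) * (j + 1 / 2) * (j + 1 + A)) /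
        ((j + 1) * (j + 1 / 2 + A) * (j + 2) * (j + 3 / 2 + A)) := by
    rw [div_eq_div_iff (by positivity) hD]
    ring
  have L3 : (1 : ℝ) = ((j + 2) * (j + 1) * (j + 3 / 2 + A) * (j + 1 / 2 + A)) /
        ((j + 1) * (j + 1 / 2 + A) * (j + 2) * (j + 3 / 2 + A)) := by
    rw [eq_div_iff hD]
    ring
  have R1 : (k + 1) * (k + 1 - A) * ((k ^ 2 - A * k + A ^ 2) / ((k + 1) * (k + 1 - A))) *
      ((j + 1 / 2) * (j + 1 + A) / ((j + 1) * (j + 1 / 2 + A)) / ((j + 1 / 2) * (j + 1 + A))) =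
      ((j + 2) * (j + 3 / 2 + A) * (k ^ 2 - A * k + A ^ 2)) /
        ((j + 1) * (j + 1 / 2 + A) * (j + 2) * (j + 3 / 2 + A)) := by
    rw [mul_div_cancel₀ _ (mul_ne_zero e1 e2), div_div_cancel_left' (mul_ne_zero e7 e8),
      ← one_div, mul_one_div, div_eq_div_iff (by positivity) hD]
    ring
  have R2 : (j + 1 / 2) * (j + 1 + A) / ((j + 1) * (j + 1 / 2 + A)) *
      ((j + 1 + 1 / 2) * (j + 1 + 1 + A) / ((j + 1 + 1) * (j + 1 + 1 / 2 + A))) /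
      ((j + 3 / 2) * (j + 2 + A)) = ((j + 1 / 2) * (j + 1 + A)) /
        ((j + 1) * (j + 1 / 2 + A) * (j + 2) * (j + 3 / 2 + A)) := by
    rw [L1, div_div, div_eq_div_iff (by positivity) hD]
    ring
  generalize (j + 1) * (j + 1 / 2 + A) * (j + 2) * (j + 3 / 2 + A) = D at *
  generalize c₁ A (k + j + 1) = p₁ at *
  generalize c₀ A (k + j + 1) = p₀ at *
  generalize c₂ A (k + j + 1) = p₂ at *
  generalize y A (k + j + 1) k = y₀ at *
  generalize y A (k + j + 1) (k + 1) = y₁ at *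
  linear_combination a * b * (p₁ * L1 + p₀ * L2 + p₂ * L3 - y₁ * R1 + y₀ * k * (k - A) * R2)
    + a * b / D * key

open ConvRec in
theorem convSum_rec {A : ℝ} (h0 : 0 < A) (h1 : A < 1) (m : ℕ) :
    c₁ A (m + 1) * convSum A (m + 2) + c₀ A (m + 1) * convSum A (m + 1)
      + c₂ A (m + 1) * convSum A m = 0 := by
  set F : ℕ → ℝ := fun k => y A (m + 1) k * k * (k - A) * gaussTerm A k
    * (slowQuot A (m + 2 - k) / ((m + 2 - k - 1 / 2) * (m + 2 - k + A))) with hF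
  have hsum : ∑ k ∈ Finset.range (m + 1),
      (c₁ A (m + 1) * (slowQuot A (m + 2 - k) * gaussTerm A k)
      + c₀ A (m + 1) * (slowQuot A (m + 1 - k) * gaussTerm A k)
      + c₂ A (m + 1) * (slowQuot A (m - k) * gaussTerm A k)) = F (m + 1) - F 0 := by
    rw [← Finset.sum_range_sub]
    refine Finset.sum_congr rfl fun k hk => ?_
    obtain ⟨j, rfl⟩ := Nat.exists_eq_add_of_le (Nat.lt_succ_iff.1 (Finset.mem_range.1 hk))
    have := convSum_term_telescope h0 h1 k j
    rw [show k + j + 2 - k = j + 2 by omega, show k + j + 1 - k = j + 1 by omega,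
      show k + j - k = j by omega]
    push_cast
    rw [this, hF]
    simp only []
    rw [show k + j + 2 - (k + 1) = j + 1 by omega, show k + j + 2 - k = j + 2 by omega]
    push_cast
    ring_nf
  have hF0 : F 0 = 0 := by simp [hF]
  have e2 : convSum A (m + 2) = ∑ k ∈ Finset.range (m + 1), slowQuot A (m + 2 - k) * gaussTerm A k
      + slowQuot A 1 * gaussTerm A (m + 1) + slowQuot A 0 * gaussTerm A (m + 2) := by
    unfold convSum
    rw [Finset.sum_range_succ, Finset.sum_range_succ, show m + 2 - (m + 1) = 1 by omega,
      Nat.sub_self]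
  have e1 : convSum A (m + 1) = ∑ k ∈ Finset.range (m + 1), slowQuot A (m + 1 - k) * gaussTerm A k
      + slowQuot A 0 * gaussTerm A (m + 1) := by
    unfold convSum
    rw [Finset.sum_range_succ, Nat.sub_self]
  rw [Finset.sum_add_distrib, Finset.sum_add_distrib, ← Finset.mul_sum, ← Finset.mul_sum,
    ← Finset.mul_sum, hF0, sub_zero] at hsum
  -- The summands `k = m + 1` and `k = m + 2` are outside the telescoped range, where the truncated
  -- subtractions would be wrong; they cancel the boundary value `F (m + 1)`.
  have hedge : F (m + 1) + c₁ A (m + 1) * (slowQuot A 1 * gaussTerm A (m + 1)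
      + slowQuot A 0 * gaussTerm A (m + 2)) + c₀ A (m + 1) * (slowQuot A 0 * gaussTerm A (m + 1))
      = 0 := by
    have s1 : slowQuot A 1 = (1 / 2 * (1 + A)) / (1 / 2 + A) := by
      simp [slowQuot]
    have s0 : slowQuot A 0 = 1 := by simp [slowQuot]
    have hm : (0 : ℝ) ≤ m := m.cast_nonneg
    simp only [hF]
    rw [show m + 2 - (m + 1) = 1 by omega, s1, s0, gaussTerm_succ A (m + 1)]
    generalize gaussTerm A (m + 1) = b
    push_cast
    generalize (m : ℝ) = x at *
    have e1 : x + 1 + 1 ≠ 0 := by positivity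
    have e2 : x + 1 + 1 - A ≠ 0 := by linarith
    have e3 : 1 / 2 + A ≠ 0 := by positivity
    have e4 : 1 + A ≠ 0 := by positivity
    rw [show x + 2 - (x + 1) - 1 / 2 = 1 / 2 by ring, show x + 2 - (x + 1) + A = 1 + A by ring,
      div_div_cancel_left' (by positivity)]
    field_simp
    unfold c₁ c₀ y
    ring
  unfold convSum at *
  rw [e2, e1]
  linear_combination hsum + hedge

/-! ### The alternating generating function at even truncations. -/

/-- Generating functions in `L` of the truncated sums over words alternating between
`(-1) ^ k / k ^ 2` and `1 / k`, with outermost letter `(-1) ^ k / k ^ 2` (first component) or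
`1 / k` (second component). -/
noncomputable def altPair (L : ℝ) : ℕ → ℝ × ℝ
  | 0 => (1, 0)
  | N + 1 => ((altPair L N).1 + (-1) ^ (N + 1) / ((N : ℝ) + 1) ^ 2 * (altPair L N).2,
      (altPair L N).2 + L / ((N : ℝ) + 1) * (altPair L N).1)

theorem altPair_fst_succ (L : ℝ) (N : ℕ) : (altPair L (N + 1)).1 =
    (altPair L N).1 + (-1) ^ (N + 1) / ((N : ℝ) + 1) ^ 2 * (altPair L N).2 := rfl

theorem altPair_snd_succ (L : ℝ) (N : ℕ) : (altPair L (N + 1)).2 =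
    (altPair L N).2 + L / ((N : ℝ) + 1) * (altPair L N).1 := rfl

-- The values at `2 * m`, `2 * m + 2` and `2 * m + 4` are linear forms in the two components at `2 *
-- m`, hence linearly dependent. Even steps fix the signs.
open ConvRec in
theorem altPair_rec (A : ℝ) (m : ℕ) :
    (2 * ((m : ℝ) + 1)) * (2 * (m + 1) - 1) *
      ((2 * (m + 1) + 1) ^ 2 * (2 * (m + 1) + 2) ^ 2 * (4 * (m + 1) - 1)
          * (altPair (8 * A ^ 3) (2 * (m + 2))).1
        + c₀ A (m + 1) * (altPair (8 * A ^ 3) (2 * (m + 1))).1)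
      + ((2 * (m + 1)) ^ 3 - 8 * A ^ 3) * ((2 * (m + 1) - 1) ^ 3 + 8 * A ^ 3) * (4 * (m + 1) + 3)
          * (altPair (8 * A ^ 3) (2 * m)).1 = 0 := by
  rw [show 2 * (m + 2) = 2 * m + 1 + 1 + 1 + 1 by ring, show 2 * (m + 1) = 2 * m + 1 + 1 by ring]
  simp only [altPair_fst_succ, altPair_snd_succ]
  generalize (altPair (8 * A ^ 3) (2 * m)).1 = a
  generalize (altPair (8 * A ^ 3) (2 * m)).2 = b
  have e1 : (-1 : ℝ) ^ (2 * m + 1) = -1 := Odd.neg_one_pow ⟨m, rfl⟩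
  simp only [pow_succ (-1 : ℝ) (2 * m + 1 + 1 + 1), pow_succ (-1 : ℝ) (2 * m + 1 + 1),
    pow_succ (-1 : ℝ) (2 * m + 1), e1]
  have hm : (0 : ℝ) ≤ m := m.cast_nonneg
  push_cast
  generalize (m : ℝ) = x at *
  unfold c₀
  have h1 : 2 * x + 1 ≠ 0 := by positivity
  have h2 : 2 * x + 1 + 1 ≠ 0 := by positivity
  have h3 : 2 * x + 1 + 1 + 1 ≠ 0 := by positivity
  have h4 : 2 * x + 1 + 1 + 1 + 1 ≠ 0 := by positivity
  field_simp
  ring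

-- Multiplication by `normQuot` turns the recurrence of `convSum` into that of `altPair`: the cubic
-- factors `(2x)^3 - 8A^3` and `(2x-1)^3 + 8A^3` split off the linear factors of `normQuot`. Two
-- initial values then suffice.
open ConvRec in
theorem altPair_eq_convSum {A : ℝ} (h0 : 0 < A) (h1 : A < 1) (m : ℕ) :
    (altPair (8 * A ^ 3) (2 * m)).1 = normQuot A m * convSum A m := by
  induction m using Nat.twoStepInduction with
  | zero => simp [altPair, normQuot, convSum, slowQuot, gaussTerm]
  | one =>
    have e : (1 / 2 : ℝ) + A ≠ 0 := by positivity
    have e' : 1 - A ≠ 0 := by linarith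
    simp [altPair, normQuot, convSum, slowQuot, gaussTerm, Finset.sum_range_succ]
    field_simp
    ring
  | more m ih0 ih1 =>
    have hG := altPair_rec A m
    have hS := convSum_rec h0 h1 m
    rw [ih0, ih1] at hG
    have p1 := normQuot_succ A m
    have p2 := normQuot_succ A (m + 1)
    have hm : (0 : ℝ) ≤ m := m.cast_nonneg
    rw [show m + 2 = m + 1 + 1 from rfl] at hG hS ⊢
    rw [p2, p1]
    rw [p1] at hG
    push_cast at *
    generalize (altPair (8 * A ^ 3) (2 * (m + 1 + 1))).1 = g at *
    generalize convSum A (m + 1 + 1) = s2 at *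
    generalize convSum A (m + 1) = s1 at *
    generalize convSum A m = s0 at *
    generalize normQuot A m = p at *
    generalize (m : ℝ) = x at *
    have hd : (2 * (x + 1)) * (2 * (x + 1) - 1) * ((2 * (x + 1) + 1) ^ 2 * (2 * (x + 1) + 2) ^ 2
        * (4 * (x + 1) - 1)) ≠ 0 := by
      have : 0 < 2 * (x + 1) - 1 := by linarith
      have : 0 < 4 * (x + 1) - 1 := by linarith
      positivity
    refine mul_left_cancel₀ hd ?_
    have q1 : (2 * (x + 1) + 1) ^ 2 * (2 * (x + 1) + 2) ^ 2 * (4 * (x + 1) - 1) *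
        ((x + 1 + 1 / 2 + A) * (x + 1 + 1 - A) / ((x + 1 + 1 / 2) * (x + 1 + 1)))
        = c₁ A (x + 1) := by
      unfold c₁
      field_simp
      ring
    have q0 : ((2 * (x + 1)) ^ 3 - 8 * A ^ 3) * ((2 * (x + 1) - 1) ^ 3 + 8 * A ^ 3)
          * (4 * (x + 1) + 3) = (2 * (x + 1)) * (2 * (x + 1) - 1) * c₂ A (x + 1) *
        ((x + 1 / 2 + A) * (x + 1 - A) / ((x + 1 / 2) * (x + 1))) := by
      unfold c₂
      field_simp
      ring
    rw [q0] at hG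
    generalize (x + 1 / 2 + A) * (x + 1 - A) / ((x + 1 / 2) * (x + 1)) = r at *
    generalize (x + 1 + 1 / 2 + A) * (x + 1 + 1 - A) / ((x + 1 + 1 / 2) * (x + 1 + 1)) = r' at *
    generalize c₀ A (x + 1) = k0 at *
    generalize c₂ A (x + 1) = k2 at *
    generalize c₁ A (x + 1) = k1 at *
    linear_combination hG - (2 * (x + 1)) * (2 * (x + 1) - 1) * p * r * hS
      - (2 * (x + 1)) * (2 * (x + 1) - 1) * p * r * s2 * q1

/-! ### Asymptotics of the convolution. -/

theorem prod_one_add_le_two {f : ℕ → ℝ} (hf : ∀ i, 0 ≤ f i)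
    (hf' : ∀ i : ℕ, f i ≤ 1 / (4 * ((i : ℝ) + 1) ^ 2)) (m : ℕ) :
    ∏ i ∈ Finset.range m, (1 + f i) ≤ 2 - 1 / ((m : ℝ) + 1) := by
  induction m with
  | zero => norm_num
  | succ m ih =>
    rw [Finset.prod_range_succ]
    have hm : (0 : ℝ) ≤ m := m.cast_nonneg
    have hx := hf' m
    have hx0 := hf m
    push_cast
    calc _ ≤ (2 - 1 / ((m : ℝ) + 1)) * (1 + 1 / (4 * ((m : ℝ) + 1) ^ 2)) := by
          have : 0 ≤ 2 - 1 / ((m : ℝ) + 1) := by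
            rw [sub_nonneg, div_le_iff₀ (by positivity)]
            linarith
          gcongr
      _ ≤ _ := by
          rw [← sub_nonneg]
          have : 2 - 1 / ((m : ℝ) + 1 + 1) - (2 - 1 / ((m : ℝ) + 1)) *
              (1 + 1 / (4 * ((m : ℝ) + 1) ^ 2)) =
              (2 * (m : ℝ) ^ 2 + 3 * m + 2) / (4 * (m + 1) ^ 3 * (m + 1 + 1)) := by
            field_simp
            ring
          rw [this]
          positivity

theorem le_prod_one_sub {f : ℕ → ℝ} (hf : ∀ i, 0 ≤ f i)
    (hf' : ∀ i : ℕ, f i ≤ 1 / (4 * ((i : ℝ) + 1) ^ 2)) (m : ℕ) :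
    1 / 2 + 1 / (2 * ((m : ℝ) + 1)) ≤ ∏ i ∈ Finset.range m, (1 - f i) := by
  induction m with
  | zero => norm_num
  | succ m ih =>
    rw [Finset.prod_range_succ]
    have hm : (0 : ℝ) ≤ m := m.cast_nonneg
    have hx := hf' m
    have hx0 := hf m
    have hq : 1 / (4 * ((m : ℝ) + 1) ^ 2) ≤ 1 := by
      rw [div_le_one (by positivity)]
      nlinarith
    push_cast
    calc _ ≤ (1 / 2 + 1 / (2 * ((m : ℝ) + 1))) * (1 - 1 / (4 * ((m : ℝ) + 1) ^ 2)) := by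
          rw [← sub_nonneg]
          have : (1 / 2 + 1 / (2 * ((m : ℝ) + 1))) * (1 - 1 / (4 * ((m : ℝ) + 1) ^ 2)) -
              (1 / 2 + 1 / (2 * ((m : ℝ) + 1 + 1))) =
              (3 * (m : ℝ) ^ 2 + 4 * m) / (8 * (m + 1) ^ 3 * (m + 1 + 1)) := by
            field_simp
            ring
          rw [this]
          positivity
      _ ≤ _ := by
          have h1 : 0 ≤ 1 - 1 / (4 * ((m : ℝ) + 1) ^ 2) := by linarith
          have h2 : 0 ≤ ∏ i ∈ Finset.range m, (1 - f i) := le_trans (by positivity) ih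
          gcongr

theorem slowQuot_factor {A : ℝ} (h0 : 0 < A) (i : ℕ) :
    (((i : ℝ) + 1 / 2) * (i + 1 + A)) / ((i + 1) * (i + 1 / 2 + A)) =
      1 - A / 2 / ((i + 1) * (i + 1 / 2 + A)) := by
  have hi : (0 : ℝ) ≤ i := i.cast_nonneg
  field_simp
  ring

theorem slowQuot_defect_nonneg {A : ℝ} (h0 : 0 < A) (i : ℕ) :
    0 ≤ A / 2 / (((i : ℝ) + 1) * (i + 1 / 2 + A)) := by
  positivity

theorem slowQuot_defect_le {A : ℝ} (h0 : 0 < A) (h1 : A < 1 / 8) (i : ℕ) :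
    A / 2 / (((i : ℝ) + 1) * (i + 1 / 2 + A)) ≤ 1 / (4 * ((i : ℝ) + 1) ^ 2) := by
  have hi : (0 : ℝ) ≤ i := i.cast_nonneg
  rw [div_le_div_iff₀ (by positivity) (by positivity)]
  nlinarith

theorem half_le_slowQuot {A : ℝ} (h0 : 0 < A) (h1 : A < 1 / 8) (m : ℕ) :
    1 / 2 ≤ slowQuot A m := by
  have := le_prod_one_sub (slowQuot_defect_nonneg h0) (slowQuot_defect_le h0 h1) m
  unfold slowQuot
  simp_rw [slowQuot_factor h0]
  refine le_trans ?_ this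
  have : (0 : ℝ) ≤ 1 / (2 * ((m : ℝ) + 1)) := by positivity
  linarith

theorem slowQuot_antitone {A : ℝ} (h0 : 0 < A) (h1 : A < 1 / 8) : Antitone (slowQuot A) := by
  refine antitone_nat_of_succ_le fun n => ?_
  rw [slowQuot_succ, slowQuot_factor h0]
  have := slowQuot_defect_nonneg h0 n
  exact mul_le_of_le_one_right (by linarith [half_le_slowQuot h0 h1 n]) (by linarith)

theorem exists_tendsto_slowQuot {A : ℝ} (h0 : 0 < A) (h1 : A < 1 / 8) :
    ∃ a, Tendsto (slowQuot A) atTop (𝓝 a) :=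
  ⟨_, tendsto_atTop_ciInf (slowQuot_antitone h0 h1)
    ⟨1 / 2, by rintro _ ⟨m, rfl⟩; exact half_le_slowQuot h0 h1 m⟩⟩

theorem slowQuot_le_one {A : ℝ} (h0 : 0 < A) (h1 : A < 1 / 8) (m : ℕ) : slowQuot A m ≤ 1 := by
  simpa [slowQuot] using slowQuot_antitone h0 h1 (Nat.zero_le m)

/-- For a Gauss series whose lower parameter is `1 + B + C`, here `1 - A`, the partial sums at
argument 1 are themselves Pochhammer quotients. -/
theorem sum_gaussTerm {A : ℝ} (h1 : A < 1) (m : ℕ) :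
    ∑ k ∈ Finset.range (m + 1), gaussTerm A k =
      ∏ i ∈ Finset.range m, (1 + A ^ 2 / (((i : ℝ) + 1) * (i + 1 - A))) := by
  -- The second conjunct expresses the next term through the product, which is what the induction
  -- step adds.
  have key : ∀ m : ℕ, ∑ k ∈ Finset.range (m + 1), gaussTerm A k =
      ∏ i ∈ Finset.range m, (1 + A ^ 2 / (((i : ℝ) + 1) * (i + 1 - A))) ∧
      gaussTerm A (m + 1) * (((m : ℝ) + 1) * (m + 1 - A)) =
        A ^ 2 * ∏ i ∈ Finset.range m, (1 + A ^ 2 / (((i : ℝ) + 1) * (i + 1 - A))) := by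
    intro m
    induction m with
    | zero =>
      have : 1 - A ≠ 0 := by linarith
      simp [gaussTerm]
      field_simp
    | succ m ih =>
      obtain ⟨ih1, ih2⟩ := ih
      have hm : (0 : ℝ) ≤ m := m.cast_nonneg
      have e1 : (m : ℝ) + 1 - A ≠ 0 := by linarith
      have e2 : (m : ℝ) + 1 + 1 - A ≠ 0 := by linarith
      rw [Finset.sum_range_succ, ih1, gaussTerm_succ A (m + 1), Finset.prod_range_succ]
      generalize ∏ i ∈ Finset.range m, (1 + A ^ 2 / (((i : ℝ) + 1) * (i + 1 - A))) = p at *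
      have ih3 : gaussTerm A (m + 1) = A ^ 2 * p / (((m : ℝ) + 1) * (m + 1 - A)) := by
        rw [eq_div_iff (by positivity), ih2]
      rw [ih3]
      push_cast
      constructor
      · field_simp
      · field_simp
  exact (key m).1

theorem gaussTerm_nonneg {A : ℝ} (h1 : A < 1) (k : ℕ) : 0 ≤ gaussTerm A k := by
  refine Finset.prod_nonneg fun i _ => ?_
  have hi : (0 : ℝ) ≤ i := i.cast_nonneg
  refine div_nonneg (by nlinarith [sq_nonneg ((i : ℝ) - A / 2), sq_nonneg A])
    (mul_nonneg (by positivity) (by linarith))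

theorem summable_gaussTerm {A : ℝ} (h0 : 0 < A) (h1 : A < 1 / 8) : Summable (gaussTerm A) := by
  refine summable_of_sum_range_le (c := 2) (gaussTerm_nonneg (by linarith)) fun n => ?_
  refine (Finset.sum_le_sum_of_subset_of_nonneg (Finset.range_subset_range.2 (Nat.le_succ n))
    fun i _ _ => gaussTerm_nonneg (by linarith) i).trans ?_
  rw [sum_gaussTerm (by linarith)]
  refine (prod_one_add_le_two (fun i => ?_) (fun i => ?_) n).trans ?_
  · have hi : (0 : ℝ) ≤ i := i.cast_nonneg
    exact div_nonneg (by positivity) (mul_nonneg (by positivity) (by linarith))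
  · have hi : (0 : ℝ) ≤ i := i.cast_nonneg
    have : 0 < (i : ℝ) + 1 - A := by linarith
    rw [div_le_div_iff₀ (by positivity) (by positivity)]
    have hA : A ^ 2 ≤ 1 / 64 := by nlinarith
    have : A ^ 2 * (4 * ((i : ℝ) + 1) ^ 2) ≤ 1 / 64 * (4 * ((i : ℝ) + 1) ^ 2) := by gcongr
    nlinarith
  · have : (0 : ℝ) ≤ 1 / ((n : ℝ) + 1) := by positivity
    linarith

theorem normQuot_mul_slowQuot {A : ℝ} (h0 : 0 < A) (m : ℕ) : normQuot A m * slowQuot A m =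
    ∏ i ∈ Finset.range m, (1 - A ^ 2 / ((i : ℝ) + 1) ^ 2) := by
  unfold normQuot slowQuot
  rw [← Finset.prod_mul_distrib]
  refine Finset.prod_congr rfl fun i _ => ?_
  have hi : (0 : ℝ) ≤ i := i.cast_nonneg
  field_simp
  ring

theorem normQuot_nonneg {A : ℝ} (h0 : 0 < A) (h1 : A < 1) (m : ℕ) : 0 ≤ normQuot A m := by
  refine Finset.prod_nonneg fun i _ => ?_
  have hi : (0 : ℝ) ≤ i := i.cast_nonneg
  have : 0 < (i : ℝ) + 1 - A := by linarith
  positivity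

theorem normQuot_le_two {A : ℝ} (h0 : 0 < A) (h1 : A < 1 / 8) (m : ℕ) : normQuot A m ≤ 2 := by
  have h := normQuot_mul_slowQuot h0 m
  have hle : ∏ i ∈ Finset.range m, (1 - A ^ 2 / ((i : ℝ) + 1) ^ 2) ≤ 1 := by
    refine Finset.prod_le_one (fun i _ => ?_) (fun i _ => ?_)
    · have hi : (0 : ℝ) ≤ i := i.cast_nonneg
      rw [sub_nonneg, div_le_one (by positivity)]
      nlinarith
    · have : 0 ≤ A ^ 2 / ((i : ℝ) + 1) ^ 2 := by positivity
      linarith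
  nlinarith [half_le_slowQuot h0 h1 m, normQuot_nonneg h0 (by linarith) m]

/-- Factorwise, with `t = i + 1`: `(1 - A²/t²)(1 + A²/(t(t - A))) = 1 + A³/t³`. -/
theorem prod_one_add_cube {A : ℝ} (h0 : 0 < A) (h1 : A < 1) (m : ℕ) :
    ∏ i ∈ Finset.range m, (1 + A ^ 3 / ((i : ℝ) + 1) ^ 3) =
      normQuot A m * slowQuot A m * ∑ k ∈ Finset.range (m + 1), gaussTerm A k := by
  rw [normQuot_mul_slowQuot h0, sum_gaussTerm h1, ← Finset.prod_mul_distrib]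
  refine Finset.prod_congr rfl fun i _ => ?_
  have hi : (0 : ℝ) ≤ i := i.cast_nonneg
  have : (i : ℝ) + 1 - A ≠ 0 := by linarith
  field_simp
  ring

/-- Dominated convergence: for fixed `k`, `slowQuot A (m - k) - slowQuot A m` tends to 0, and it
stays in `[0, 1]`, so `gaussTerm A` dominates. -/
theorem tendsto_convSum_sub {A : ℝ} (h0 : 0 < A) (h1 : A < 1 / 8) :
    Tendsto (fun m => convSum A m - slowQuot A m * ∑ k ∈ Finset.range (m + 1), gaussTerm A k)
      atTop (𝓝 0) := by
  obtain ⟨a, ha⟩ := exists_tendsto_slowQuot h0 h1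
  have h := tendsto_tsum_of_dominated_convergence (𝓕 := atTop)
    (f := fun m k => if k ∈ Finset.range (m + 1) then
      (slowQuot A (m - k) - slowQuot A m) * gaussTerm A k else 0) (g := fun _ => (0 : ℝ))
    (summable_gaussTerm h0 h1) (fun k => ?_) (Eventually.of_forall fun m k => ?_)
  · rw [tsum_zero] at h
    refine h.congr fun m => ?_
    rw [tsum_eq_sum (s := Finset.range (m + 1)) (fun k hk => if_neg hk),
      Finset.sum_congr rfl (fun k hk => if_pos hk), convSum, Finset.mul_sum,
      ← Finset.sum_sub_distrib]
    exact Finset.sum_congr rfl fun k _ => by ring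
  · have h2 : Tendsto (fun m => (slowQuot A (m - k) - slowQuot A m) * gaussTerm A k) atTop
        (𝓝 ((a - a) * gaussTerm A k)) :=
      ((ha.comp (tendsto_sub_atTop_nat k)).sub ha).mul_const _
    rw [sub_self, zero_mul] at h2
    refine h2.congr' ?_
    filter_upwards [eventually_ge_atTop k] with m hm
    rw [if_pos (Finset.mem_range.2 (Nat.lt_succ_of_le hm))]
  · have hb := gaussTerm_nonneg (A := A) (by linarith) k
    split_ifs with hk
    · have h2 := slowQuot_antitone h0 h1 (Nat.sub_le m k)
      have h3 := slowQuot_le_one h0 h1 (m - k)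
      have h4 := half_le_slowQuot h0 h1 m
      rw [Real.norm_eq_abs, abs_of_nonneg (mul_nonneg (by linarith) hb)]
      exact mul_le_of_le_one_left hb (by linarith)
    · simpa using hb

theorem tendsto_altPair_sub_prod {A : ℝ} (h0 : 0 < A) (h1 : A < 1 / 8) :
    Tendsto (fun m => (altPair (8 * A ^ 3) (2 * m)).1 -
      ∏ i ∈ Finset.range m, (1 + A ^ 3 / ((i : ℝ) + 1) ^ 3)) atTop (𝓝 0) := by
  have h := tendsto_convSum_sub h0 h1
  have h2 : Tendsto (fun m => normQuot A m * (convSum A m -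
      slowQuot A m * ∑ k ∈ Finset.range (m + 1), gaussTerm A k)) atTop (𝓝 0) := by
    refine bdd_le_mul_tendsto_zero' 2 (Eventually.of_forall fun m => ?_) h
    rw [abs_of_nonneg (normQuot_nonneg h0 (by linarith) m)]
    exact normQuot_le_two h0 h1 m
  refine h2.congr fun m => ?_
  rw [altPair_eq_convSum h0 (by linarith), prod_one_add_cube h0 (by linarith)]
  ring

/-! ### Generating functions of the truncated sums. -/

namespace SignedIndex

/-- Truncated sum of `ζ({2,1}^n)` with the sign `x` on every entry `2`. -/
noncomputable def twoOne (x : ℤˣ) (n N : ℕ) : ℝ := eulerPartialSum (rep [(2, x), (1, 1)] n) N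

/-- Truncated sum of `ζ(1,{2,1}^n)` with the sign `x` on every entry `2`. -/
noncomputable def oneTwoOne (x : ℤˣ) (n N : ℕ) : ℝ :=
  eulerPartialSum ((1, 1) :: rep [(2, x), (1, 1)] n) N

/-- Truncated sum of `ζ({3}^n)`. -/
noncomputable def threes (n N : ℕ) : ℝ := eulerPartialSum (rep [(3, 1)] n) N

theorem twoOne_zero_left (x : ℤˣ) (N : ℕ) : twoOne x 0 N = 1 := eulerPartialSum_nil N

theorem threes_zero_left (N : ℕ) : threes 0 N = 1 := eulerPartialSum_nil N

theorem twoOne_succ_zero (x : ℤˣ) (n : ℕ) : twoOne x (n + 1) 0 = 0 := by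
  unfold twoOne
  rw [rep_succ]
  exact eulerPartialSum_cons_zero _ _

theorem threes_succ_zero (n : ℕ) : threes (n + 1) 0 = 0 := by
  unfold threes
  rw [rep_succ]
  exact eulerPartialSum_cons_zero _ _

theorem oneTwoOne_zero (x : ℤˣ) (n : ℕ) : oneTwoOne x n 0 = 0 := eulerPartialSum_cons_zero _ _

theorem twoOne_succ_succ (x : ℤˣ) (n N : ℕ) : twoOne x (n + 1) (N + 1) =
    twoOne x (n + 1) N + ((x : ℤ) : ℝ) ^ (N + 1) / ((N : ℝ) + 1) ^ 2 * oneTwoOne x n N := by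
  unfold twoOne oneTwoOne
  rw [rep_succ]
  exact eulerPartialSum_cons_succ _ _ _

theorem threes_succ_succ (n N : ℕ) : threes (n + 1) (N + 1) =
    threes (n + 1) N + 1 / ((N : ℝ) + 1) ^ 3 * threes n N := by
  unfold threes
  rw [rep_succ]
  refine (eulerPartialSum_cons_succ _ _ _).trans ?_
  simp

theorem oneTwoOne_succ (x : ℤˣ) (n N : ℕ) : oneTwoOne x n (N + 1) =
    oneTwoOne x n N + 1 / ((N : ℝ) + 1) * twoOne x n N := by
  unfold twoOne oneTwoOne
  refine (eulerPartialSum_cons_succ _ _ _).trans ?_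
  simp

theorem hasSum_altPair (L : ℝ) (N : ℕ) :
    HasSum (fun n => twoOne (-1) n N * L ^ n) (altPair L N).1 ∧
    HasSum (fun n => oneTwoOne (-1) n N * L ^ (n + 1)) (altPair L N).2 := by
  induction N with
  | zero =>
    refine ⟨?_, ?_⟩
    · convert hasSum_ite_eq (0 : ℕ) (1 : ℝ) using 1
      · funext n
        cases n <;> simp [twoOne_zero_left, twoOne_succ_zero]
      · rfl
    · simp [oneTwoOne_zero, altPair]
  | succ N ih =>
    obtain ⟨h1, h2⟩ := ih
    refine ⟨?_, ?_⟩
    · rw [altPair_fst_succ]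
      have h3 := ((hasSum_nat_add_iff' 1).2 h1).add
        (h2.mul_left ((-1) ^ (N + 1) / ((N : ℝ) + 1) ^ 2))
      refine (hasSum_nat_add_iff' 1).1 ?_
      convert h3 using 1
      · funext n
        rw [twoOne_succ_succ]
        push_cast
        ring
      · simp only [Finset.range_one, Finset.sum_singleton, twoOne_zero_left]
        ring
    · rw [altPair_snd_succ]
      convert h2.add (h1.mul_left (L / ((N : ℝ) + 1))) using 1
      funext n
      rw [oneTwoOne_succ]
      ring

theorem hasSum_threes (L : ℝ) (N : ℕ) : HasSum (fun n => threes n N * L ^ n)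
    (∏ i ∈ Finset.range N, (1 + L / ((i : ℝ) + 1) ^ 3)) := by
  induction N with
  | zero =>
    convert hasSum_ite_eq (0 : ℕ) (1 : ℝ) using 1
    · funext n
      cases n <;> simp [threes_zero_left, threes_succ_zero]
    · simp
  | succ N ih =>
    have h3 := ((hasSum_nat_add_iff' 1).2 ih).add (ih.mul_left (L / ((N : ℝ) + 1) ^ 3))
    refine (hasSum_nat_add_iff' 1).1 ?_
    convert h3 using 1
    · funext n
      rw [threes_succ_succ]
      ring
    · rw [Finset.prod_range_succ]
      simp only [Finset.range_one, Finset.sum_singleton, threes_zero_left]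
      ring

/-! ### Uniform bounds and convergence. -/

theorem abs_twoOne_le (N : ℕ) : ∀ n, |twoOne (-1) n N| ≤ twoOne 1 n N ∧
    |oneTwoOne (-1) n N| ≤ oneTwoOne 1 n N := by
  induction N with
  | zero =>
    intro n
    cases n <;> simp [twoOne_zero_left, twoOne_succ_zero, oneTwoOne_zero]
  | succ N ih =>
    intro n
    constructor
    · cases n with
      | zero => simp [twoOne_zero_left]
      | succ n =>
        rw [twoOne_succ_succ, twoOne_succ_succ]
        refine (abs_add_le _ _).trans (add_le_add (ih _).1 ?_)
        rw [abs_mul]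
        refine mul_le_mul (le_of_eq ?_) (ih n).2 (abs_nonneg _) (by simp; positivity)
        rw [abs_div, abs_of_nonneg (by positivity : (0 : ℝ) ≤ ((N : ℝ) + 1) ^ 2)]
        simp
    · rw [oneTwoOne_succ, oneTwoOne_succ]
      refine (abs_add_le _ _).trans (add_le_add (ih _).2 ?_)
      rw [abs_mul, abs_of_nonneg (by positivity : (0 : ℝ) ≤ 1 / ((N : ℝ) + 1))]
      exact mul_le_mul_of_nonneg_left (ih n).1 (by positivity)

theorem dist_twoOne_succ_le (n N : ℕ) : dist (twoOne (-1) n N) (twoOne (-1) n (N + 1)) ≤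
    twoOne 1 n (N + 1) - twoOne 1 n N := by
  cases n with
  | zero => simp [twoOne_zero_left]
  | succ n =>
    rw [twoOne_succ_succ, twoOne_succ_succ, dist_self_add_right, add_sub_cancel_left,
      Real.norm_eq_abs, abs_mul]
    refine mul_le_mul (le_of_eq ?_) (abs_twoOne_le N n).2 (abs_nonneg _) (by simp; positivity)
    rw [abs_div, abs_of_nonneg (by positivity : (0 : ℝ) ≤ ((N : ℝ) + 1) ^ 2)]
    simp

/-- Joint induction with the harmonic number `h`: a bound 2 on the first quantity makes the second
grow by at most `1 / (4 * (N + 1))`, and the resulting increments `h / (4 * (N + 1) ^ 2)` of the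
first are absorbed by the subtracted term, chosen to telescope. -/
theorem twoOne_mul_pow_bound (N : ℕ) : ∀ n,
    twoOne 1 n N * (1 / 8) ^ n ≤
      2 - (∑ i ∈ Finset.range N, 1 / ((i : ℝ) + 1) + 2) / (2 * ((N : ℝ) + 1)) ∧
    oneTwoOne 1 n N * (1 / 8) ^ (n + 1) ≤ (∑ i ∈ Finset.range N, 1 / ((i : ℝ) + 1)) / 4 := by
  induction N with
  | zero =>
    intro n
    cases n <;> simp [twoOne_zero_left, twoOne_succ_zero, oneTwoOne_zero] <;> norm_num
  | succ N ih =>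
    intro n
    have hN : (0 : ℝ) ≤ N := N.cast_nonneg
    have hh : 0 ≤ ∑ i ∈ Finset.range N, 1 / ((i : ℝ) + 1) :=
      Finset.sum_nonneg fun i _ => by positivity
    have hstep : 2 - (∑ i ∈ Finset.range N, 1 / ((i : ℝ) + 1) + 2) / (2 * ((N : ℝ) + 1))
        + (∑ i ∈ Finset.range N, 1 / ((i : ℝ) + 1)) / 4 / ((N : ℝ) + 1) ^ 2 ≤
        2 - (∑ i ∈ Finset.range (N + 1), 1 / ((i : ℝ) + 1) + 2) / (2 * (((N + 1 : ℕ) : ℝ) + 1)) := by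
      rw [Finset.sum_range_succ]
      generalize ∑ i ∈ Finset.range N, 1 / ((i : ℝ) + 1) = h at *
      push_cast
      rw [← sub_nonneg]
      have : 2 - (h + 1 / ((N : ℝ) + 1) + 2) / (2 * ((N : ℝ) + 1 + 1)) -
          (2 - (h + 2) / (2 * ((N : ℝ) + 1)) + h / 4 / ((N : ℝ) + 1) ^ 2) =
          (h * N + 2 * N + 2) / (4 * ((N : ℝ) + 1) ^ 2 * (N + 1 + 1)) := by
        field_simp
        ring
      rw [this]
      positivity
    have hfst : ∀ n, twoOne 1 n N * (1 / 8) ^ n ≤ 2 := fun n => by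
      refine (ih n).1.trans ?_
      have : 0 ≤ (∑ i ∈ Finset.range N, 1 / ((i : ℝ) + 1) + 2) / (2 * ((N : ℝ) + 1)) := by
        positivity
      linarith
    constructor
    · refine le_trans ?_ hstep
      cases n with
      | zero =>
        have h1 := (ih 0).1
        rw [twoOne_zero_left] at *
        have : 0 ≤ (∑ i ∈ Finset.range N, 1 / ((i : ℝ) + 1)) / 4 / ((N : ℝ) + 1) ^ 2 := by
          positivity
        linarith
      | succ n =>
        rw [twoOne_succ_succ, add_mul]
        refine add_le_add (ih _).1 ?_
        calc _ = oneTwoOne 1 n N * (1 / 8) ^ (n + 1) / ((N : ℝ) + 1) ^ 2 := by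
              simp
              ring
          _ ≤ _ := by
              gcongr
              exact (ih n).2
    · rw [oneTwoOne_succ, Finset.sum_range_succ, add_mul, add_div]
      refine add_le_add (ih n).2 ?_
      calc _ = 1 / 8 * (1 / ((N : ℝ) + 1)) * (twoOne 1 n N * (1 / 8) ^ n) := by ring
        _ ≤ 1 / 8 * (1 / ((N : ℝ) + 1)) * 2 := by
            gcongr
            exact hfst n
        _ = _ := by ring

theorem twoOne_mul_pow_le_two (n N : ℕ) : twoOne 1 n N * (1 / 8) ^ n ≤ 2 := by
  refine (twoOne_mul_pow_bound N n).1.trans ?_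
  have : 0 ≤ (∑ i ∈ Finset.range N, 1 / ((i : ℝ) + 1) + 2) / (2 * ((N : ℝ) + 1)) := by
    have : 0 ≤ ∑ i ∈ Finset.range N, 1 / ((i : ℝ) + 1) :=
      Finset.sum_nonneg fun i _ => by positivity
    positivity
  linarith

theorem threes_nonneg (N : ℕ) : ∀ n, 0 ≤ threes n N := by
  induction N with
  | zero =>
    intro n
    cases n <;> simp [threes_zero_left, threes_succ_zero]
  | succ N ih =>
    intro n
    cases n with
    | zero => simp [threes_zero_left]
    | succ n =>
      rw [threes_succ_succ]
      have := ih n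
      have := ih (n + 1)
      positivity

theorem threes_monotone (n : ℕ) : Monotone (threes n) := by
  refine monotone_nat_of_le_succ fun N => ?_
  cases n with
  | zero => simp [threes_zero_left]
  | succ n =>
    rw [threes_succ_succ]
    have := threes_nonneg N n
    exact le_add_of_nonneg_right (by positivity)

theorem threes_mul_pow_bound (N : ℕ) : ∀ n, threes n N * (1 / 4) ^ n ≤ 2 - 1 / ((N : ℝ) + 1) := by
  induction N with
  | zero =>
    intro n
    cases n <;> simp [threes_zero_left, threes_succ_zero] <;> norm_num
  | succ N ih =>
    intro n
    have hN : (0 : ℝ) ≤ N := N.cast_nonneg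
    cases n with
    | zero =>
      rw [threes_zero_left]
      have : 1 / (((N + 1 : ℕ) : ℝ) + 1) ≤ 1 := by
        rw [div_le_one (by positivity)]
        push_cast
        linarith
      simp only [pow_zero]
      linarith
    | succ n =>
      rw [threes_succ_succ, add_mul]
      have h2 : threes n N * (1 / 4) ^ n ≤ 2 := by
        have : 0 ≤ 1 / ((N : ℝ) + 1) := by positivity
        linarith [ih n]
      calc _ ≤ (2 - 1 / ((N : ℝ) + 1)) + 1 / 4 * (1 / ((N : ℝ) + 1) ^ 3) * 2 := by
            refine add_le_add (ih _) ?_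
            calc _ = 1 / 4 * (1 / ((N : ℝ) + 1) ^ 3) * (threes n N * (1 / 4) ^ n) := by ring
              _ ≤ _ := by gcongr
        _ ≤ _ := by
            push_cast
            rw [← sub_nonneg]
            have : 2 - 1 / ((N : ℝ) + 1 + 1) -
                (2 - 1 / ((N : ℝ) + 1) + 1 / 4 * (1 / ((N : ℝ) + 1) ^ 3) * 2) =
                (2 * (N : ℝ) ^ 2 + 3 * N) / (2 * (N + 1) ^ 3 * (N + 1 + 1)) := by
              field_simp
              ring
            rw [this]
            positivity

theorem threes_mul_pow_le_two (n N : ℕ) : threes n N * (1 / 4) ^ n ≤ 2 := by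
  refine (threes_mul_pow_bound N n).trans ?_
  have : 0 ≤ 1 / ((N : ℝ) + 1) := by positivity
  linarith

theorem exists_tendsto_threes (n : ℕ) : ∃ z, Tendsto (threes n) atTop (𝓝 z) := by
  refine ⟨_, tendsto_atTop_ciSup (threes_monotone n) ⟨2 / (1 / 4) ^ n, ?_⟩⟩
  rintro _ ⟨N, rfl⟩
  rw [le_div_iff₀ (by positivity)]
  exact threes_mul_pow_le_two n N

theorem exists_tendsto_twoOne (n : ℕ) : ∃ z, Tendsto (twoOne (-1) n) atTop (𝓝 z) := by
  refine cauchySeq_tendsto_of_complete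
    (cauchySeq_of_dist_le_of_summable _ (dist_twoOne_succ_le n) ?_)
  refine summable_of_sum_range_le (c := 2 / (1 / 8) ^ n)
    (fun N => dist_nonneg.trans (dist_twoOne_succ_le n N)) fun N => ?_
  rw [Finset.sum_range_sub]
  have h0 : 0 ≤ twoOne 1 n 0 := (abs_nonneg _).trans (abs_twoOne_le 0 n).1
  have h1 : twoOne 1 n N ≤ 2 / (1 / 8) ^ n := by
    rw [le_div_iff₀ (by positivity)]
    exact twoOne_mul_pow_le_two n N
  linarith

end SignedIndex

/-! ### Comparison of power series coefficients. -/

/-- Passing to the limit in the coefficients of a power series. -/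
theorem tendsto_tsum_mul_pow {ι : Type*} {l : Filter ι} {a : ℕ → ι → ℝ} {b : ℕ → ℝ} {C r x : ℝ}
    (hx : 0 < x) (hxr : x ≤ r / 2) (ha : ∀ n i, |a n i| * r ^ n ≤ C)
    (hb : ∀ n, Tendsto (a n) l (𝓝 (b n))) :
    Tendsto (fun i => ∑' n, a n i * x ^ n) l (𝓝 (∑' n, b n * x ^ n)) := by
  refine tendsto_tsum_of_dominated_convergence (bound := fun n => C * (1 / 2) ^ n)
    (summable_geometric_two.mul_left C) (fun n => (hb n).mul_const _)
    (Eventually.of_forall fun i n => ?_)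
  rw [norm_mul, Real.norm_eq_abs, Real.norm_of_nonneg (by positivity)]
  calc |a n i| * x ^ n ≤ |a n i| * (r / 2) ^ n := by gcongr
    _ = |a n i| * r ^ n * (1 / 2) ^ n := by
      rw [div_eq_mul_one_div, mul_pow, mul_assoc]
    _ ≤ _ := by
      gcongr
      exact ha n i

/-- A power series vanishing on an interval `(0, ρ)` has zero coefficients. -/
theorem coeff_eq_zero_of_tsum_eq_zero {c : ℕ → ℝ} {C r ρ : ℝ} (hr : 0 < r) (hρ : 0 < ρ)
    (hc : ∀ n, |c n| * r ^ n ≤ C) (h : ∀ x, 0 < x → x < ρ → ∑' n, c n * x ^ n = 0) (n : ℕ) :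
    c n = 0 := by
  induction n using Nat.strong_induction_on with
  | _ n ih =>
    -- Once the lower coefficients vanish, divide by `x ^ n` and let `x` tend to 0 from the right;
    -- `x ≤ r / 2` gives a geometric majorant.
    have hpos : 0 < min ρ (r / 2) := lt_min hρ (by positivity)
    have hbound : ∀ x, 0 < x → x < min ρ (r / 2) → ∀ k,
        ‖c (k + n) * x ^ k‖ ≤ C / r ^ n * (1 / 2) ^ k := by
      intro x hx hx' k
      rw [norm_mul, Real.norm_eq_abs, Real.norm_of_nonneg (by positivity)]
      have hxr : x ≤ r / 2 := (hx'.trans_le (min_le_right _ _)).le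
      calc |c (k + n)| * x ^ k ≤ |c (k + n)| * (r / 2) ^ k := by gcongr
        _ = |c (k + n)| * r ^ (k + n) / r ^ n * (1 / 2) ^ k := by
          rw [div_eq_mul_one_div r, mul_pow, pow_add]
          field_simp
        _ ≤ _ := by
          gcongr
          exact hc _
    have hzero : ∀ x, 0 < x → x < min ρ (r / 2) → ∑' k, c (k + n) * x ^ k = 0 := by
      intro x hx hx'
      have hs : Summable fun k => c (k + n) * x ^ k :=
        .of_norm_bounded (summable_geometric_two.mul_left _) (hbound x hx hx')
      have hs' : Summable fun k => c k * x ^ k := by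
        rw [← summable_nat_add_iff n]
        refine (hs.mul_left (x ^ n)).congr fun k => ?_
        ring
      have := hs'.sum_add_tsum_nat_add n
      rw [h x hx (hx'.trans_le (min_le_left _ _)), Finset.sum_eq_zero fun k hk => by
        rw [ih k (Finset.mem_range.1 hk), zero_mul], zero_add] at this
      have h2 : x ^ n * ∑' k, c (k + n) * x ^ k = 0 := by
        rw [← tsum_mul_left, ← this]
        exact tsum_congr fun k => by ring
      exact (mul_eq_zero.1 h2).resolve_left (by positivity)
    have hev : ∀ᶠ x : ℝ in 𝓝[>] 0, 0 < x ∧ x < min ρ (r / 2) :=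
      (eventually_mem_nhdsWithin).and (eventually_nhdsWithin_of_eventually_nhds
        (eventually_lt_nhds hpos))
    have hlim := tendsto_tsum_of_dominated_convergence (𝓕 := 𝓝[>] (0 : ℝ))
      (f := fun x k => c (k + n) * x ^ k) (g := fun k => c (k + n) * 0 ^ k)
      (bound := fun k => C / r ^ n * (1 / 2) ^ k) (summable_geometric_two.mul_left _)
      (fun k => ((continuous_id.pow k).tendsto' 0 _ rfl |>.mono_left nhdsWithin_le_nhds).const_mul _)
      (hev.mono fun x hx => hbound x hx.1 hx.2)
    have hlim' : Tendsto (fun x : ℝ => ∑' k, c (k + n) * x ^ k) (𝓝[>] 0) (𝓝 0) :=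
      tendsto_const_nhds.congr' (hev.mono fun x hx => (hzero x hx.1 hx.2).symm)
    have := tendsto_nhds_unique hlim hlim'
    rw [tsum_eq_single 0 (fun k hk => by simp [hk])] at this
    simpa using this

namespace SignedIndex

theorem lim_twoOne_eq {z w : ℕ → ℝ} (hz : ∀ n, Tendsto (twoOne (-1) n) atTop (𝓝 (z n)))
    (hw : ∀ n, Tendsto (threes n) atTop (𝓝 (w n))) (n : ℕ) : w n = 8 ^ n * z n := by
  have hz2 : ∀ n N, |twoOne (-1) n N| * (1 / 8) ^ n ≤ 2 := fun n N =>
    (mul_le_mul_of_nonneg_right (abs_twoOne_le N n).1 (by positivity)).trans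
      (twoOne_mul_pow_le_two n N)
  -- The division by `8 ^ n` rewrites a series in `A ^ 3` as one in `x = 8 * A ^ 3`.
  have hw2 : ∀ n N, |threes n N / 8 ^ n| * (1 / 8) ^ n ≤ 2 := fun n N => by
    refine le_trans ?_ (threes_mul_pow_le_two n N)
    rw [abs_of_nonneg (div_nonneg (threes_nonneg N n) (by positivity)), div_eq_mul_one_div,
      mul_assoc, ← one_div_pow, ← mul_pow]
    have := threes_nonneg N n
    gcongr
    norm_num
  have hw' : ∀ n, Tendsto (fun N => threes n N / 8 ^ n) atTop (𝓝 (w n / 8 ^ n)) :=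
    fun n => (hw n).div_const _
  have hzb : ∀ n, |z n| * (1 / 8) ^ n ≤ 2 := fun n =>
    le_of_tendsto' ((hz n).abs.mul_const _) (hz2 n)
  have hwb : ∀ n, |w n / 8 ^ n| * (1 / 8) ^ n ≤ 2 := fun n =>
    le_of_tendsto' ((hw' n).abs.mul_const _) (hw2 n)
  have hsummable : ∀ {b : ℕ → ℝ} {x : ℝ}, 0 < x → x < 1 / 64 →
      (∀ n, |b n| * (1 / 8) ^ n ≤ 2) → Summable fun n => b n * x ^ n := by
    intro b x hx hx' hb
    refine .of_norm_bounded (summable_geometric_two.mul_left 2) fun n => ?_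
    rw [norm_mul, Real.norm_eq_abs, Real.norm_of_nonneg (by positivity)]
    calc |b n| * x ^ n ≤ |b n| * (1 / 8 * (1 / 2)) ^ n := by
          gcongr
          linarith
      _ = |b n| * (1 / 8) ^ n * (1 / 2) ^ n := by rw [mul_pow, mul_assoc]
      _ ≤ _ := by
          gcongr
          exact hb n
  have key : z n - w n / 8 ^ n = 0 := by
    refine coeff_eq_zero_of_tsum_eq_zero (c := fun n => z n - w n / 8 ^ n) (C := 4) (r := 1 / 8)
      (ρ := 1 / 64) (by norm_num) (by norm_num) (fun n => ?_) (fun x hx hx' => ?_) n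
    · have h1 := abs_sub (z n) (w n / 8 ^ n)
      nlinarith [hzb n, hwb n, (by positivity : (0 : ℝ) < (1 / 8) ^ n)]
    -- The radius `1 / 64` is `8 * (1 / 8) ^ 3`, so `x < 1 / 64` gives `A < 1 / 8`.
    · obtain ⟨A, hA0, hA⟩ : ∃ A : ℝ, 0 < A ∧ 8 * A ^ 3 = x := by
        refine ⟨(x / 8) ^ ((3 : ℕ) : ℝ)⁻¹, by positivity, ?_⟩
        rw [Real.rpow_inv_natCast_pow (by positivity) (by norm_num)]
        ring
      have hA1 : A < 1 / 8 := by
        refine lt_of_pow_lt_pow_left₀ 3 (by norm_num) ?_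
        norm_num
        linarith
      -- Only even truncations `2 * m` are compared; the limits exist already, so a subsequence
      -- suffices.
      have h1 := (tendsto_tsum_mul_pow (r := 1 / 8) (x := x) hx (by linarith)
        hz2 hz).comp (tendsto_id.const_mul_atTop' (by norm_num : 0 < 2))
      have h2 := tendsto_tsum_mul_pow (r := 1 / 8) (x := x) hx (by linarith)
        hw2 hw'
      have h3 := tendsto_altPair_sub_prod hA0 hA1
      have h4 := h1.sub h2
      have h5 := tendsto_nhds_unique (h4.congr fun m => ?_) h3
      · simp_rw [sub_mul]
        rw [(hsummable hx hx' hzb).tsum_sub (hsummable hx hx' hwb)]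
        exact h5
      · have e1 := (hasSum_altPair x (2 * m)).1.tsum_eq
        have e2 := (hasSum_threes (A ^ 3) m).tsum_eq
        rw [hA, ← e1, ← e2]
        refine congrArg₂ _ rfl (tsum_congr fun n => ?_)
        rw [← hA, mul_pow]
        field_simp
  rw [sub_eq_zero] at key
  rw [key]
  field_simp

end SignedIndex

theorem theorem4p1 (n : ℕ) (hn : 0 < n) :
    SignedIndex.EulerConverges (SignedIndex.rep [(3, 1)] n) ∧
    SignedIndex.EulerConverges (SignedIndex.rep [(2, -1), (1, 1)] n) ∧
    SignedIndex.eulerSum (SignedIndex.rep [(3, 1)] n) =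
      8 ^ n * SignedIndex.eulerSum (SignedIndex.rep [(2, -1), (1, 1)] n) := by
  choose z hz using SignedIndex.exists_tendsto_twoOne
  choose w hw using SignedIndex.exists_tendsto_threes
  refine ⟨⟨w n, hw n⟩, ⟨z n, hz n⟩, ?_⟩
  have h1 : SignedIndex.eulerSum (SignedIndex.rep [(3, 1)] n) = w n := (hw n).limUnder_eq
  have h2 : SignedIndex.eulerSum (SignedIndex.rep [(2, -1), (1, 1)] n) = z n :=
    (hz n).limUnder_eq
  rw [h1, h2]
  exact SignedIndex.lim_twoOne_eq hz hw n
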